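/- Let $M$ be a (non-empty, complete, bounded) metric structure in the sense of continuous logic. For a tuple of variables $x$ let $S_x(M)$ be the compact Hausdorff space of complete types over $M$ in $x$. An $M$-definable predicate $\phi(x)$ is a uniform limit of formulas with parameters in $M$, regarded as a continuous real-valued function on $S_x(M)$. A Keisler measure on $x$ is a regular Borel probability measure on $S_x(M)$; the set of these is denoted $\mathfrak{M}_x(M)$. Let $n \ge 1$, let $x_1,\dots,x_n$ be tuples of variables, $x=(x_1,\dots,x_n)$ their concatenation, and let $\mu_i \in \mathfrak{M}_{x_i}(M)$ for $1\le i\le n$. A measure $\omega \in \mathfrak{M}_{x}(M)$ is called a product measure of $\mu_1,\dots,\mu_n$ if $$\int_{S_x(M)} \prod_{i=1}^n \theta_i(x_i)\,d\omega = \prod_{i=1}^n \int_{S_{x_i}(M)} \theta_i(x_i)\,d\mu_i$$ for all $M$-definable predicates $\theta_1(x_1),\dots,\theta_n(x_n)$, and $\mu_1,\dots,\mu_n$ are called weakly orthogonal if they have exactly one product measure. Then $\mu_1,\dots,\mu_n$ are weakly orthogonal if and only if for every $M$-definable predicate $\phi(x_1,\dots,x_n)$ and every $\varepsilon>0$ there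 exist $M$-definable predicates $\psi^-(x_1,\dots,x_n)$ and $\psi^+(x_1,\dots,x_n)$, each of the form $\psi^{\pm}(x_1,\dots,x_n)=\sum_{j=1}^{m^{\pm}} \prod_{i=1}^n \theta^{\pm}_{ij}(x_i)$ with $M$-definable predicates $\theta^{\pm}_{ij}(x_i)$, such that - $\psi^-(x_1,\dots,x_n) \le \phi(x_1,\dots,x_n) \le \psi^+(x_1,\dots,x_n)$ for all $(x_1,\dots,x_n)$ (that is, at every type in $S_x(M)$), and - $\int_{S_{x}(M)} (\psi^+-\psi^-)\,d\omega \le \varepsilon$ for every product measure $\omega$ of $\mu_1,\dots,\mu_n$. -/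

import Mathlib

open MeasureTheory

universe u v w x y

noncomputable section

/-- A (one-sorted) language for metric structures: function and predicate symbols, a bound on the
diameter, a closed bounded interval of values for each predicate symbol, and moduli of uniform
continuity for all symbols. -/
structure MetricLanguage extends FirstOrder.Language where
  /-- bound on the diameter of the structures -/
  diam : ℝ
  /-- left end of the interval of values of a predicate symbol -/
  lo : ∀ {k : ℕ}, Relations k → ℝ
  /-- right end of the interval of values of a predicate symbol -/
  hi : ∀ {k : ℕ}, Relations k → ℝ
  /-- modulus of uniform continuity of a function symbol -/
  funMod : ∀ {k : ℕ}, Functions k → ℝ → ℝ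
  /-- modulus of uniform continuity of a predicate symbol -/
  predMod : ∀ {k : ℕ}, Relations k → ℝ → ℝ
  funMod_pos : ∀ {k : ℕ} (f : Functions k) (ε : ℝ), 0 < ε → 0 < funMod f ε
  predMod_pos : ∀ {k : ℕ} (P : Relations k) (ε : ℝ), 0 < ε → 0 < predMod P ε

namespace MetricLanguage

/-- The interpretation of the symbols of `L` that makes the metric space `M` a metric structure.
(The space is also required to be non-empty and complete, through the usual classes.
Finite powers of `M` carry the maximum metric.) -/
class Interpretation (L : MetricLanguage.{u, v}) (M : Type w) [MetricSpace M] where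
  /-- interpretation of function symbols -/
  funMap : ∀ {k : ℕ}, L.Functions k → (Fin k → M) → M
  /-- interpretation of predicate symbols -/
  predMap : ∀ {k : ℕ}, L.Relations k → (Fin k → M) → ℝ
  dist_le_diam : ∀ a b : M, dist a b ≤ L.diam
  predMap_mem : ∀ {k : ℕ} (P : L.Relations k) (a : Fin k → M),
    predMap P a ∈ Set.Icc (L.lo P) (L.hi P)
  funMap_unif : ∀ {k : ℕ} (f : L.Functions k) (ε : ℝ), 0 < ε → ∀ a b : Fin k → M,
    dist a b < L.funMod f ε → dist (funMap f a) (funMap f b) ≤ ε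
  predMap_unif : ∀ {k : ℕ} (P : L.Relations k) (ε : ℝ), 0 < ε → ∀ a b : Fin k → M,
    dist a b < L.predMod P ε → |predMap P a - predMap P b| ≤ ε

/-- Formulas of continuous logic with free variables in `β` and `n` further variables
that are available for quantification. -/
inductive BForm (L : MetricLanguage.{u, v}) (β : Type x) : ℕ → Type (max u v x)
  /-- atomic formula `d(s, t)` -/
  | dist {n : ℕ} (s t : L.toLanguage.Term (β ⊕ Fin n)) : BForm L β n
  /-- atomic formula `P(t₁, …, t_k)` -/
  | pred {n k : ℕ} (P : L.Relations k) (t : Fin k → L.toLanguage.Term (β ⊕ Fin n)) : BForm L β n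
  /-- continuous connective `u(φ₁, …, φ_k)` -/
  | conn {n k : ℕ} (u : C(Fin k → ℝ, ℝ)) (φ : Fin k → BForm L β n) : BForm L β n
  /-- quantifier `inf` over the last variable -/
  | inf {n : ℕ} (φ : BForm L β (n + 1)) : BForm L β n
  /-- quantifier `sup` over the last variable -/
  | sup {n : ℕ} (φ : BForm L β (n + 1)) : BForm L β n

/-- Formulas of continuous logic with free variables in `β`. -/
abbrev Form (L : MetricLanguage.{u, v}) (β : Type x) := BForm L β 0

section Semantics

variable {L : MetricLanguage.{u, v}} {M : Type w} [MetricSpace M] [L.Interpretation M]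
  {β : Type x} {γ : Type y}

/-- The value of a term in a metric structure. -/
def termVal (e : β → M) : L.toLanguage.Term β → M
  | .var b => e b
  | .func f t => Interpretation.funMap (L := L) f fun i => termVal e (t i)

/-- The value of a formula in a metric structure. (All values of a formula lie in a bounded
interval, so that the infima and suprema are genuine.) -/
def BForm.val (e : β → M) : {n : ℕ} → BForm L β n → (Fin n → M) → ℝ
  | _, .dist s t, b => Dist.dist (termVal (Sum.elim e b) s) (termVal (Sum.elim e b) t)
  | _, .pred P t, b => Interpretation.predMap (L := L) P fun i => termVal (Sum.elim e b) (t i)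
  | _, .conn u φ, b => u fun i => (φ i).val e b
  | _, .inf φ, b => ⨅ a : M, φ.val e (Fin.snoc b a)
  | _, .sup φ, b => ⨆ a : M, φ.val e (Fin.snoc b a)

/-- The value `φ(e)` of a formula at an assignment `e` of its free variables. -/
def Form.value (φ : Form L β) (e : β → M) : ℝ := φ.val e Fin.elim0

/-- Renaming of the free variables of a formula. -/
def BForm.rename (g : β → γ) : {n : ℕ} → BForm L β n → BForm L γ n
  | _, .dist s t => .dist (s.relabel (Sum.map g id)) (t.relabel (Sum.map g id))
  | _, .pred P t => .pred P fun i => (t i).relabel (Sum.map g id)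
  | _, .conn u φ => .conn u fun i => (φ i).rename g
  | _, .inf φ => .inf (φ.rename g)
  | _, .sup φ => .sup (φ.rename g)

theorem termVal_relabel (g : β → γ) (e : γ → M) (t : L.toLanguage.Term β) :
    termVal (L := L) e (t.relabel g) = termVal (L := L) (e ∘ g) t := by
  induction t with
  | var b => rfl
  | func f t ih => simp only [FirstOrder.Language.Term.relabel, termVal, ih]

theorem BForm.val_rename (g : β → γ) (e : γ → M) {n : ℕ} (φ : BForm L β n) :
    ∀ b : Fin n → M, (φ.rename g).val e b = φ.val (e ∘ g) b := by
  induction φ with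
  | dist s t => intro b; simp [BForm.rename, BForm.val, termVal_relabel, Sum.elim_comp_map]
  | pred P t => intro b; simp [BForm.rename, BForm.val, termVal_relabel, Sum.elim_comp_map]
  | conn u φ ih => intro b; simp [BForm.rename, BForm.val, ih]
  | inf φ ih => intro b; simp [BForm.rename, BForm.val, ih]
  | sup φ ih => intro b; simp [BForm.rename, BForm.val, ih]

end Semantics

/-- The complete types over the model `M` in the tuple of variables `X`. Formulas with parameters
in `M` and free variables in `X` are formulas with free variables in `M ⊕ X`, where `a : M`
stands for itself. A complete type gives to each such formula `φ` a value `p φ`, in such a way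
that the set of conditions `φ = p φ` is consistent: any finitely many of them are satisfied in
`M` up to an arbitrarily small error. (By the compactness theorem these are exactly the types over
`M` of the `X`-tuples in elementary extensions of `M`.) -/
def TypeSpace (L : MetricLanguage.{u, v}) (M : Type w) [MetricSpace M] [L.Interpretation M]
    (X : Type x) : Type (max u v w x) :=
  {p : Form L (M ⊕ X) → ℝ // ∀ (s : Finset (Form L (M ⊕ X))) (ε : ℝ), 0 < ε →
    ∃ a : X → M, ∀ φ ∈ s, |φ.value (Sum.elim id a) - p φ| < ε}

section Types

variable {L : MetricLanguage.{u, v}} {M : Type w} [MetricSpace M] [L.Interpretation M]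

/-- The logic topology: the coarsest topology for which `p ↦ p φ` is continuous for each `φ`. -/
instance (X : Type x) : TopologicalSpace (TypeSpace L M X) :=
  inferInstanceAs (TopologicalSpace (Subtype _))

instance (X : Type x) : MeasurableSpace (TypeSpace L M X) := borel _

instance (X : Type x) : BorelSpace (TypeSpace L M X) := ⟨rfl⟩

/-- The value of a formula at a type. -/
def TypeSpace.eval {X : Type x} (p : TypeSpace L M X) (φ : Form L (M ⊕ X)) : ℝ := p.1 φ

/-- The restriction of a type in the concatenated tuple `(x_i)_i` to the variables `x_i`. -/
def TypeSpace.restrict {I : Type y} {X : I → Type x} (i : I) (p : TypeSpace L M (Σ i, X i)) :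
    TypeSpace L M (X i) :=
  ⟨fun φ => p.eval (φ.rename (Sum.map id (Sigma.mk i))), by
    classical
    intro s ε hε
    obtain ⟨a, ha⟩ := p.2 (s.image fun φ => φ.rename (Sum.map id (Sigma.mk i))) ε hε
    refine ⟨fun b => a ⟨i, b⟩, fun φ hφ => ?_⟩
    have h := ha _ (Finset.mem_image_of_mem _ hφ)
    rw [Form.value, BForm.val_rename, Sum.elim_comp_map] at h
    exact h⟩

/-- `M`-definable predicates: uniform limits of formulas with parameters in `M`, regarded as
functions on the space of types. -/
def IsDefinablePredicate {X : Type x} (F : TypeSpace L M X → ℝ) : Prop :=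
  ∀ ε : ℝ, 0 < ε → ∃ φ : Form L (M ⊕ X), ∀ p : TypeSpace L M X, |F p - p.eval φ| ≤ ε

/-- Keisler measures: regular Borel probability measures on the space of types. -/
def KeislerMeasure (L : MetricLanguage.{u, v}) (M : Type w) [MetricSpace M] [L.Interpretation M]
    (X : Type x) : Type (max u v w x) :=
  {μ : Measure (TypeSpace L M X) // IsProbabilityMeasure μ ∧ μ.Regular}

/-- `ω` is a product measure of the measures `μ i`: it extends the product functional. -/
def IsProductMeasure {n : ℕ} {X : Fin n → Type x} (μ : ∀ i, KeislerMeasure L M (X i))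
    (ω : KeislerMeasure L M (Σ i, X i)) : Prop :=
  ∀ θ : ∀ i, TypeSpace L M (X i) → ℝ, (∀ i, IsDefinablePredicate (θ i)) →
    ∫ p, ∏ i, θ i (p.restrict i) ∂ω.1 = ∏ i, ∫ q, θ i q ∂(μ i).1

/-- The measures `μ i` are weakly orthogonal: they have a unique product measure. -/
def WeaklyOrthogonal {n : ℕ} {X : Fin n → Type x} (μ : ∀ i, KeislerMeasure L M (X i)) : Prop :=
  ∃! ω : KeislerMeasure L M (Σ i, X i), IsProductMeasure μ ω

/-- `ψ` is of the form `∑ j, ∏ i, θ_{ij}(x_i)` with `M`-definable predicates `θ_{ij}`. -/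
def IsSumOfProducts {n : ℕ} {X : Fin n → Type x} (ψ : TypeSpace L M (Σ i, X i) → ℝ) : Prop :=
  ∃ (m : ℕ) (θ : Fin m → ∀ i, TypeSpace L M (X i) → ℝ),
    (∀ j i, IsDefinablePredicate (θ j i)) ∧ ∀ p, ψ p = ∑ j, ∏ i, θ j i (p.restrict i)

end Types

end MetricLanguage

end

/-! By Stone–Weierstrass the definable predicates are exactly the continuous functions on the
compact type space (`isDefinablePredicate_iff_continuous`). By Riesz representation, product
measures then correspond to the positive extensions to all continuous functions of one positive
functional Λ on the space W of sums of products (`isProductMeasure_iff`).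

Let p(φ) be the infimum of Λψ over ψ in W with ψ ≥ φ. It is sublinear, so Hahn–Banach gives, for
each φ, a product measure ω with ∫φ dω = p(φ) (`exists_isProductMeasure`). If the product measure is
unique, then p(-φ) = -p(φ), and near-optimal majorants of φ and -φ give ψ⁺ and -ψ⁻. Conversely, all
product measures agree on W, so a sandwich of φ with gap ε pins ∫φ dω down to within ε. -/

noncomputable section

/-! ### Extension of positive functionals, Riesz representation -/

section PositiveExtension

variable {S : Type*} [TopologicalSpace S]

/-- The infimum of the values of a functional on the elements of its domain that dominate `φ`. -/
def upperEnvelope {W : Submodule ℝ C(S, ℝ)} (Λ : W →ₗ[ℝ] ℝ) (φ : C(S, ℝ)) : ℝ :=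
  sInf (Λ '' {ψ : W | φ ≤ ψ})

variable {W : Submodule ℝ C(S, ℝ)} {Λ : W →ₗ[ℝ] ℝ}

theorem monotone_of_nonneg (hpos : ∀ f : W, 0 ≤ (f : C(S, ℝ)) → 0 ≤ Λ f) {f g : W}
    (h : (f : C(S, ℝ)) ≤ g) : Λ f ≤ Λ g := by
  have := hpos (g - f) (by simpa using h)
  rw [map_sub] at this
  linarith

variable [CompactSpace S]

/-- The constants ±‖φ‖ work. They make the set defining `upperEnvelope` non-empty and bounded below,
so that its `sInf` is not the default value 0. -/
theorem exists_dominating (h1 : (1 : C(S, ℝ)) ∈ W) (φ : C(S, ℝ)) :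
    ∃ c : ℝ, φ ≤ (c • (⟨1, h1⟩ : W) : W) ∧ ((-c) • (⟨1, h1⟩ : W) : W) ≤ φ := by
  refine ⟨‖φ‖, fun x => ?_, fun x => ?_⟩
  · simpa using φ.apply_le_norm x
  · simpa using φ.neg_norm_le_apply x

theorem bddBelow_upperEnvelope (h1 : (1 : C(S, ℝ)) ∈ W)
    (hpos : ∀ f : W, 0 ≤ (f : C(S, ℝ)) → 0 ≤ Λ f) (φ : C(S, ℝ)) :
    BddBelow (Λ '' {ψ : W | φ ≤ ψ}) := by
  obtain ⟨c, -, hc⟩ := exists_dominating h1 φ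
  refine ⟨Λ ((-c) • ⟨1, h1⟩), ?_⟩
  rintro _ ⟨ψ, hψ, rfl⟩
  exact monotone_of_nonneg hpos (hc.trans hψ)

theorem upperEnvelope_le (h1 : (1 : C(S, ℝ)) ∈ W)
    (hpos : ∀ f : W, 0 ≤ (f : C(S, ℝ)) → 0 ≤ Λ f) {φ : C(S, ℝ)} {ψ : W} (h : φ ≤ ψ) :
    upperEnvelope Λ φ ≤ Λ ψ :=
  csInf_le (bddBelow_upperEnvelope h1 hpos φ) ⟨ψ, h, rfl⟩

theorem exists_lt_upperEnvelope_add (h1 : (1 : C(S, ℝ)) ∈ W) (φ : C(S, ℝ)) {ε : ℝ} (hε : 0 < ε) :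
    ∃ ψ : W, φ ≤ ψ ∧ Λ ψ < upperEnvelope Λ φ + ε := by
  obtain ⟨c, hc, -⟩ := exists_dominating h1 φ
  have hne : (Λ '' {ψ : W | φ ≤ ψ}).Nonempty := ⟨_, _, hc, rfl⟩
  obtain ⟨_, ⟨ψ, hψ, rfl⟩, h⟩ := exists_lt_of_csInf_lt hne
    (lt_add_of_pos_right (upperEnvelope Λ φ) hε)
  exact ⟨ψ, hψ, h⟩

theorem upperEnvelope_add_le (h1 : (1 : C(S, ℝ)) ∈ W)
    (hpos : ∀ f : W, 0 ≤ (f : C(S, ℝ)) → 0 ≤ Λ f) (f g : C(S, ℝ)) :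
    upperEnvelope Λ (f + g) ≤ upperEnvelope Λ f + upperEnvelope Λ g := by
  refine le_of_forall_pos_le_add fun ε hε => ?_
  obtain ⟨a, ha, ha'⟩ := exists_lt_upperEnvelope_add (Λ := Λ) h1 f (half_pos hε)
  obtain ⟨b, hb, hb'⟩ := exists_lt_upperEnvelope_add (Λ := Λ) h1 g (half_pos hε)
  have := upperEnvelope_le (ψ := a + b) h1 hpos (φ := f + g) (add_le_add ha hb)
  rw [map_add] at this
  linarith

theorem upperEnvelope_smul_le (h1 : (1 : C(S, ℝ)) ∈ W)
    (hpos : ∀ f : W, 0 ≤ (f : C(S, ℝ)) → 0 ≤ Λ f) {c : ℝ} (hc : 0 < c) (f : C(S, ℝ)) :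
    upperEnvelope Λ (c • f) ≤ c * upperEnvelope Λ f := by
  refine le_of_forall_pos_le_add fun ε hε => ?_
  obtain ⟨a, ha, ha'⟩ := exists_lt_upperEnvelope_add (Λ := Λ) h1 f (div_pos hε hc)
  have := upperEnvelope_le (ψ := c • a) h1 hpos (φ := c • f)
    (fun x => mul_le_mul_of_nonneg_left (ha x) hc.le)
  rw [map_smul, smul_eq_mul] at this
  calc _ ≤ c * Λ a := this
    _ ≤ c * (upperEnvelope Λ f + ε / c) := by gcongr
    _ = _ := by field_simp

theorem upperEnvelope_smul (h1 : (1 : C(S, ℝ)) ∈ W)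
    (hpos : ∀ f : W, 0 ≤ (f : C(S, ℝ)) → 0 ≤ Λ f) {c : ℝ} (hc : 0 < c) (f : C(S, ℝ)) :
    upperEnvelope Λ (c • f) = c * upperEnvelope Λ f := by
  refine le_antisymm (upperEnvelope_smul_le h1 hpos hc f) ?_
  have := upperEnvelope_smul_le h1 hpos (inv_pos.2 hc) (c • f)
  rwa [inv_smul_smul₀ hc.ne', ← div_eq_inv_mul, le_div_iff₀' hc] at this

theorem upperEnvelope_zero (h1 : (1 : C(S, ℝ)) ∈ W)
    (hpos : ∀ f : W, 0 ≤ (f : C(S, ℝ)) → 0 ≤ Λ f) : upperEnvelope Λ 0 = 0 := by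
  have := upperEnvelope_smul h1 hpos (c := 2) two_pos 0
  rw [smul_zero] at this
  linarith

/-- A positive functional on a space of continuous functions that contains the constants extends to
a positive functional that attains the upper envelope at a given function. -/
theorem exists_positive_extension (h1 : (1 : C(S, ℝ)) ∈ W)
    (hpos : ∀ f : W, 0 ≤ (f : C(S, ℝ)) → 0 ≤ Λ f) (φ : C(S, ℝ)) :
    ∃ F : C(S, ℝ) →ₗ[ℝ] ℝ, (∀ f, 0 ≤ f → 0 ≤ F f) ∧ (∀ f : W, F f = Λ f) ∧
      F φ = upperEnvelope Λ φ := by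
  have h0 := upperEnvelope_zero h1 hpos
  -- Well-definedness of c • φ ↦ c p(φ) on the line spanned by φ, which may be zero.
  have H : ∀ c : ℝ, c • φ = 0 → RingHom.id ℝ c • upperEnvelope Λ φ = 0 := by
    intro c hc
    rcases smul_eq_zero.1 hc with rfl | rfl
    · simp
    · simp [h0]
  obtain ⟨F, hF, hle⟩ := exists_extension_of_le_sublinear
    (LinearPMap.mkSpanSingleton' φ (upperEnvelope Λ φ) H) (upperEnvelope Λ)
    (fun c hc f => upperEnvelope_smul h1 hpos hc f) (upperEnvelope_add_le h1 hpos) (by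
      rintro ⟨_, hx⟩
      obtain ⟨c, rfl⟩ := Submodule.mem_span_singleton.1 hx
      rw [LinearPMap.mkSpanSingleton'_apply, RingHom.id_apply, smul_eq_mul]
      rcases lt_trichotomy c 0 with hc | rfl | hc
      -- For c < 0: 0 = p(cφ + (-c)φ) ≤ p(cφ) - c p(φ).
      · have h := upperEnvelope_add_le h1 hpos (c • φ) ((-c) • φ)
        rw [← add_smul, add_neg_cancel, zero_smul, h0,
          upperEnvelope_smul h1 hpos (neg_pos.2 hc)] at h
        linarith
      · simp [h0]
      · exact (upperEnvelope_smul h1 hpos hc φ).ge)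
  refine ⟨F, fun f hf => ?_, fun f => le_antisymm ?_ ?_, ?_⟩
  -- Positivity comes from F ≤ p: if f ≥ 0, then 0 in W dominates -f, so F(-f) ≤ Λ0 = 0.
  · have := (hle (-f)).trans (upperEnvelope_le (ψ := 0) h1 hpos (by simpa using hf))
    rw [map_neg, map_zero] at this
    linarith
  · exact (hle f).trans (upperEnvelope_le h1 hpos le_rfl)
  · have := (hle (-f)).trans (upperEnvelope_le (ψ := -f) h1 hpos le_rfl)
    rw [map_neg, map_neg] at this
    linarith
  · have := hF ⟨φ, Submodule.mem_span_singleton_self φ⟩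
    exact this.trans (LinearPMap.mkSpanSingleton'_apply_self _ _ _ _)

variable [T2Space S] [MeasurableSpace S] [BorelSpace S]

theorem exists_regular_measure (F : C(S, ℝ) →ₗ[ℝ] ℝ) (hF : ∀ f, 0 ≤ f → 0 ≤ F f) :
    ∃ ω : Measure S, ω.Regular ∧ ∀ f : C(S, ℝ), ∫ x, f x ∂ω = F f := by
  let G : CompactlySupportedContinuousMap S ℝ →ₚ[ℝ] ℝ := PositiveLinearMap.mk₀
    { toFun := fun f => F f.toContinuousMap
      map_add' := fun f g => map_add F f.toContinuousMap g.toContinuousMap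
      map_smul' := fun c f => map_smul F c f.toContinuousMap } fun f hf => hF _ hf
  refine ⟨RealRMK.rieszMeasure G, inferInstance, fun f => ?_⟩
  exact RealRMK.integral_rieszMeasure G (CompactlySupportedContinuousMap.continuousMapEquiv f)

theorem regular_measure_ext {μ ν : Measure S} [μ.Regular] [ν.Regular]
    (h : ∀ f : C(S, ℝ), ∫ x, f x ∂μ = ∫ x, f x ∂ν) : μ = ν :=
  Measure.ext_of_integral_eq_on_compactlySupported fun f => h f.toContinuousMap

theorem exists_regular_probability_extension (h1 : (1 : C(S, ℝ)) ∈ W)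
    (hpos : ∀ f : W, 0 ≤ (f : C(S, ℝ)) → 0 ≤ Λ f) (hone : Λ ⟨1, h1⟩ = 1) (φ : C(S, ℝ)) :
    ∃ ω : Measure S, IsProbabilityMeasure ω ∧ ω.Regular ∧
      (∀ f : W, ∫ x, (f : C(S, ℝ)) x ∂ω = Λ f) ∧ ∫ x, φ x ∂ω = upperEnvelope Λ φ := by
  obtain ⟨F, hF, hFΛ, hφ⟩ := exists_positive_extension h1 hpos φ
  obtain ⟨ω, hω, hint⟩ := exists_regular_measure F hF
  refine ⟨ω, ⟨?_⟩, hω, fun f => (hint f).trans (hFΛ f), (hint φ).trans hφ⟩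
  have h := (hint 1).trans ((hFΛ ⟨1, h1⟩).trans hone)
  simpa [Measure.real, ENNReal.toReal_eq_one_iff] using h

end PositiveExtension

namespace MetricLanguage

/-! ### Compactness of type spaces; definable predicates as continuous functions -/

section TypeSpaces

variable {L : MetricLanguage.{u, v}} {M : Type w} [MetricSpace M] [L.Interpretation M]

/-- The bound is uniform in the assignment, which places the type space inside a product of compact
intervals. -/
theorem BForm.exists_abs_val_le [Nonempty M] {β : Type x} {k : ℕ} (φ : BForm L β k) :
    ∃ C : ℝ, ∀ (e : β → M) (b : Fin k → M), |φ.val e b| ≤ C := by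
  induction φ with
  | dist s t =>
    refine ⟨L.diam, fun e b => ?_⟩
    rw [BForm.val, abs_of_nonneg dist_nonneg]
    exact Interpretation.dist_le_diam _ _
  | pred P t =>
    refine ⟨max |L.lo P| |L.hi P|, fun e b => ?_⟩
    obtain ⟨h1, h2⟩ := Interpretation.predMap_mem P fun i => termVal (Sum.elim e b) (t i)
    exact abs_le_max_abs_abs h1 h2
  | conn u φ ih =>
    choose C hC using ih
    have hK : IsCompact (Set.univ.pi fun i => Set.Icc (-C i) (C i)) :=
      isCompact_univ_pi fun i => isCompact_Icc
    obtain ⟨D, hD⟩ := hK.exists_bound_of_continuousOn u.continuous.continuousOn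
    exact ⟨D, fun e b => hD _ fun i _ => abs_le.1 (hC i e b)⟩
  | inf φ ih =>
    obtain ⟨C, hC⟩ := ih
    refine ⟨C, fun e b => abs_le.2 ⟨le_ciInf fun a => (abs_le.1 (hC e _)).1, ?_⟩⟩
    exact (ciInf_le ⟨-C, by rintro _ ⟨a, rfl⟩; exact (abs_le.1 (hC e _)).1⟩
      (Classical.arbitrary M)).trans (abs_le.1 (hC e _)).2
  | sup φ ih =>
    obtain ⟨C, hC⟩ := ih
    refine ⟨C, fun e b => abs_le.2 ⟨?_, ciSup_le fun a => (abs_le.1 (hC e _)).2⟩⟩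
    exact (abs_le.1 (hC e _)).1.trans
      (le_ciSup (f := fun a => φ.val e (Fin.snoc b a))
        ⟨C, by rintro _ ⟨a, rfl⟩; exact (abs_le.1 (hC e _)).2⟩ (Classical.arbitrary M))

namespace TypeSpace

variable {X : Type x}

instance : T2Space (TypeSpace L M X) :=
  inferInstanceAs (T2Space (Subtype _))

theorem continuous_eval (φ : Form L (M ⊕ X)) :
    Continuous fun p : TypeSpace L M X => p.eval φ :=
  (continuous_apply φ).comp continuous_subtype_val

/-- The values of the formulas at a tuple of `M`. -/
def realized (a : X → M) : Form L (M ⊕ X) → ℝ := fun φ => φ.value (Sum.elim id a)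

/-- Finite approximate satisfiability is closure in the product topology, so the type space is a
closed set of functions in which the realized types are dense. -/
theorem mem_closure_realized_iff (p : Form L (M ⊕ X) → ℝ) :
    p ∈ closure (Set.range (realized (L := L) (M := M) (X := X))) ↔
      ∀ (s : Finset (Form L (M ⊕ X))) (ε : ℝ), 0 < ε →
        ∃ a : X → M, ∀ φ ∈ s, |φ.value (Sum.elim id a) - p φ| < ε := by
  rw [mem_closure_iff_nhds]
  constructor
  · intro h s ε hε
    have : (s : Set (Form L (M ⊕ X))).pi (fun φ => Metric.ball (p φ) ε) ∈ nhds p :=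
      set_pi_mem_nhds s.finite_toSet fun φ _ => Metric.ball_mem_nhds _ hε
    obtain ⟨_, hq, a, rfl⟩ := h _ this
    exact ⟨a, fun φ hφ => hq φ hφ⟩
  · intro h t ht
    rw [nhds_pi, Filter.mem_pi'] at ht
    obtain ⟨I, V, hV, hIV⟩ := ht
    choose δ hδ hδV using fun φ => Metric.mem_nhds_iff.1 (hV φ)
    obtain ⟨ε, hε, hεI⟩ : ∃ ε > 0, ∀ φ ∈ I, ε ≤ δ φ := by
      rcases I.eq_empty_or_nonempty with rfl | hI
      · exact ⟨1, one_pos, by simp⟩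
      · exact ⟨I.inf' hI δ, (Finset.lt_inf'_iff hI).2 fun φ _ => hδ φ,
          fun φ hφ => Finset.inf'_le δ hφ⟩
    obtain ⟨a, ha⟩ := h I ε hε
    exact ⟨realized a, hIV fun φ hφ => hδV φ ((ha φ hφ).trans_le (hεI φ hφ)), a, rfl⟩

instance [Nonempty M] : CompactSpace (TypeSpace L M X) := by
  choose C hC using fun φ : Form L (M ⊕ X) => φ.exists_abs_val_le (M := M)
  have hK : IsCompact (Set.univ.pi fun φ : Form L (M ⊕ X) => Set.Icc (-C φ) (C φ)) :=
    isCompact_univ_pi fun _ => isCompact_Icc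
  have hsub : Set.range (realized (L := L) (M := M) (X := X)) ⊆
      Set.univ.pi fun φ => Set.Icc (-C φ) (C φ) := by
    rintro _ ⟨a, rfl⟩ φ -
    exact abs_le.1 (hC φ _ _)
  have h := hK.of_isClosed_subset isClosed_closure (closure_minimal hsub hK.isClosed)
  rw [Set.ext mem_closure_realized_iff] at h
  exact isCompact_iff_compactSpace.1 h

/-- The identity is a closed condition that holds at tuples of M, hence on their closure. -/
theorem eval_conn (p : TypeSpace L M X) {k : ℕ} (u : C(Fin k → ℝ, ℝ))
    (φ : Fin k → Form L (M ⊕ X)) :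
    p.eval (.conn u φ) = u fun i => p.eval (φ i) := by
  have hc : IsClosed {q : Form L (M ⊕ X) → ℝ | q (.conn u φ) = u fun i => q (φ i)} :=
    isClosed_eq (continuous_apply _)
      (u.continuous.comp (continuous_pi fun i => continuous_apply _))
  refine closure_minimal ?_ hc ((mem_closure_realized_iff p.1).2 p.2)
  rintro _ ⟨a, rfl⟩
  rfl

variable (L M X) in
/-- The algebra of functions on the type space that are given by formulas. -/
def formulaAlgebra : Subalgebra ℝ C(TypeSpace L M X, ℝ) where
  carrier := {f | ∃ φ : Form L (M ⊕ X), ∀ p, f p = p.eval φ}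
  mul_mem' := by
    rintro f g ⟨φ, hφ⟩ ⟨ψ, hψ⟩
    refine ⟨.conn ⟨fun t : Fin 2 → ℝ => t 0 * t 1, by fun_prop⟩ ![φ, ψ], fun p => ?_⟩
    simp [eval_conn, hφ, hψ]
  add_mem' := by
    rintro f g ⟨φ, hφ⟩ ⟨ψ, hψ⟩
    refine ⟨.conn ⟨fun t : Fin 2 → ℝ => t 0 + t 1, by fun_prop⟩ ![φ, ψ], fun p => ?_⟩
    simp [eval_conn, hφ, hψ]
  algebraMap_mem' r :=
    ⟨.conn ⟨fun _ : Fin 0 → ℝ => r, by fun_prop⟩ Fin.elim0, fun p => by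
      simp [eval_conn]⟩

theorem formulaAlgebra_separatesPoints : (formulaAlgebra L M X).SeparatesPoints := by
  intro p q hpq
  obtain ⟨φ, hφ⟩ : ∃ φ, p.1 φ ≠ q.1 φ := by
    by_contra! h
    exact hpq (Subtype.ext (funext h))
  exact ⟨_, ⟨⟨_, continuous_eval φ⟩, ⟨φ, fun _ => rfl⟩, rfl⟩, hφ⟩

end TypeSpace

/-- The definable predicates are exactly the continuous functions on the type space. -/
theorem isDefinablePredicate_iff_continuous [Nonempty M] {X : Type x}
    {F : TypeSpace L M X → ℝ} : IsDefinablePredicate F ↔ Continuous F := by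
  constructor
  · intro h
    refine continuous_of_uniform_approx_of_continuous fun V hV => ?_
    obtain ⟨ε, hε, hεV⟩ := Metric.mem_uniformity_dist.1 hV
    obtain ⟨φ, hφ⟩ := h (ε / 2) (half_pos hε)
    refine ⟨_, TypeSpace.continuous_eval φ, fun p => hεV ?_⟩
    exact (hφ p).trans_lt (half_lt_self hε)
  · intro h ε hε
    obtain ⟨⟨g, φ, hφ⟩, hg⟩ :=
      ContinuousMap.exists_mem_subalgebra_near_continuous_of_separatesPoints _
        (TypeSpace.formulaAlgebra_separatesPoints (L := L) (M := M) (X := X)) F h ε hε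
    refine ⟨φ, fun p => ?_⟩
    have := (hg p).le
    rwa [hφ, Real.norm_eq_abs, abs_sub_comm] at this

/-! ### Realized types and common extensions -/

namespace TypeSpace

variable {I : Type y} {X : I → Type x}

theorem continuous_restrict (i : I) :
    Continuous (restrict i : TypeSpace L M (Σ i, X i) → TypeSpace L M (X i)) :=
  Continuous.subtype_mk (continuous_pi fun _ => continuous_eval _) _

/-- The type of a tuple of `M`. -/
def ofTuple {X : Type x} (a : X → M) : TypeSpace L M X :=
  ⟨realized a, fun _ _ hε => ⟨a, fun _ _ => by simpa [realized] using hε⟩⟩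

theorem denseRange_ofTuple {X : Type x} :
    DenseRange (ofTuple : (X → M) → TypeSpace L M X) := fun p => by
  have hi : Topology.IsInducing (eval : TypeSpace L M X → Form L (M ⊕ X) → ℝ) := ⟨rfl⟩
  rw [hi.closure_eq_preimage_closure_image, ← Set.range_comp]
  exact (mem_closure_realized_iff p.1).2 p.2

theorem restrict_ofTuple (i : I) (a : (Σ i, X i) → M) :
    (ofTuple a : TypeSpace L M (Σ i, X i)).restrict i = ofTuple fun b => a ⟨i, b⟩ := by
  refine Subtype.ext (funext fun φ => ?_)
  change Form.value _ _ = Form.value _ _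
  rw [Form.value, BForm.val_rename, Sum.elim_comp_map]
  rfl

/-- Types in disjoint tuples of variables have a common extension. -/
theorem exists_restrict_eq [Nonempty M] (q : ∀ i, TypeSpace L M (X i)) :
    ∃ p : TypeSpace L M (Σ i, X i), ∀ i, p.restrict i = q i := by
  let π : TypeSpace L M (Σ i, X i) → ∀ i, TypeSpace L M (X i) := fun p i => p.restrict i
  have hπ : Continuous π := continuous_pi continuous_restrict
  -- Realized types are dense in each factor and tuples of M can be concatenated; the range of π is
  -- also compact, hence everything.
  have hd : DenseRange π := by
    refine (dense_pi Set.univ fun i _ => denseRange_ofTuple (L := L) (M := M) (X := X i)).mono ?_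
    intro r hr
    choose a ha using fun i => hr i trivial
    exact ⟨ofTuple fun b => a b.1 b.2, funext fun i => (restrict_ofTuple i _).trans (ha i)⟩
  obtain ⟨p, hp⟩ : q ∈ Set.range π := by
    rw [← (isCompact_range hπ).isClosed.closure_eq, hd.closure_eq]
    trivial
  exact ⟨p, congrFun hp⟩

end TypeSpace

end TypeSpaces

/-! ### Product measures as extensions of the product functional -/

section ProductMeasures

variable {L : MetricLanguage.{u, v}} {M : Type w} [MetricSpace M] [L.Interpretation M]
  {n : ℕ} {X : Fin n → Type x}

theorem IsDefinablePredicate.continuous [Nonempty M] {X : Type x} {F : TypeSpace L M X → ℝ}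
    (h : IsDefinablePredicate F) : Continuous F :=
  isDefinablePredicate_iff_continuous.1 h

theorem isSumOfProducts_prod {θ : ∀ i, TypeSpace L M (X i) → ℝ}
    (hθ : ∀ i, IsDefinablePredicate (θ i)) :
    IsSumOfProducts fun p : TypeSpace L M (Σ i, X i) => ∏ i, θ i (p.restrict i) :=
  ⟨1, fun _ => θ, fun _ => hθ, fun p => by simp⟩

theorem IsSumOfProducts.add {f g : TypeSpace L M (Σ i, X i) → ℝ}
    (hf : IsSumOfProducts f) (hg : IsSumOfProducts g) :
    IsSumOfProducts fun p => f p + g p := by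
  obtain ⟨k, θ, hθ, hfθ⟩ := hf
  obtain ⟨l, η, hη, hgη⟩ := hg
  refine ⟨k + l, Fin.append θ η, fun j => ?_, fun p => ?_⟩
  · refine Fin.addCases (fun j => ?_) (fun j => ?_) j
    · simpa using hθ j
    · simpa using hη j
  · simp [Fin.sum_univ_add, hfθ, hgη]

variable [Nonempty M]

theorem IsSumOfProducts.continuous {f : TypeSpace L M (Σ i, X i) → ℝ}
    (hf : IsSumOfProducts f) : Continuous f := by
  obtain ⟨k, θ, hθ, hfθ⟩ := hf
  rw [funext hfθ]
  exact continuous_finsetSum _ fun j _ => continuous_finsetProd _ fun i _ =>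
    (hθ j i).continuous.comp (TypeSpace.continuous_restrict i)

theorem IsSumOfProducts.const_mul [NeZero n] {f : TypeSpace L M (Σ i, X i) → ℝ}
    (hf : IsSumOfProducts f) (c : ℝ) : IsSumOfProducts fun p => c * f p := by
  obtain ⟨k, θ, hθ, hfθ⟩ := hf
  -- The scalar is absorbed into the factor of index 0. With n = 0 there is no factor to absorb it.
  refine ⟨k, fun j i q => (if i = 0 then c else 1) * θ j i q, fun j i => ?_, fun p => ?_⟩
  · exact isDefinablePredicate_iff_continuous.2 (continuous_const.mul (hθ j i).continuous)
  · simp_rw [hfθ, Finset.mul_sum, Finset.prod_mul_distrib]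
    simp

variable (L M X) in
/-- The space of finite sums of products of definable predicates in the separate variables. -/
def sumOfProducts [NeZero n] : Submodule ℝ C(TypeSpace L M (Σ i, X i), ℝ) where
  carrier := {f | IsSumOfProducts f}
  zero_mem' := ⟨0, Fin.elim0, fun j => j.elim0, fun p => by simp⟩
  add_mem' hf hg := hf.add hg
  smul_mem' c _ hf := hf.const_mul c

theorem one_mem_sumOfProducts [NeZero n] :
    (1 : C(TypeSpace L M (Σ i, X i), ℝ)) ∈ sumOfProducts L M X :=
  ⟨1, fun _ _ _ => 1, fun _ _ => isDefinablePredicate_iff_continuous.2 continuous_const,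
    fun p => by simp⟩

/-- A common extension of types in disjoint tuples of variables. -/
def TypeSpace.commonExtension (q : ∀ i, TypeSpace L M (X i)) : TypeSpace L M (Σ i, X i) :=
  (TypeSpace.exists_restrict_eq q).choose

theorem TypeSpace.restrict_commonExtension (q : ∀ i, TypeSpace L M (X i)) (i : Fin n) :
    (commonExtension q).restrict i = q i :=
  (TypeSpace.exists_restrict_eq q).choose_spec i

variable (μ : ∀ i, KeislerMeasure L M (X i))

instance {X : Type x} (μ : KeislerMeasure L M X) : IsProbabilityMeasure μ.1 := μ.2.1

instance {X : Type x} (μ : KeislerMeasure L M X) : μ.1.Regular := μ.2.2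

theorem KeislerMeasure.integrable {X : Type x} (μ : KeislerMeasure L M X)
    {f : TypeSpace L M X → ℝ} (hf : Continuous f) : Integrable f μ.1 :=
  hf.integrable_of_hasCompactSupport (HasCompactSupport.of_compactSpace f)

/-- The choice of common extension need not be measurable, but f sees only its restrictions, so the
composite is a sum of products of continuous functions of the separate coordinates. -/
theorem IsSumOfProducts.integrable_commonExtension {f : TypeSpace L M (Σ i, X i) → ℝ}
    (hf : IsSumOfProducts f) :
    Integrable (fun q => f (TypeSpace.commonExtension q)) (Measure.pi fun i => (μ i).1) := by
  obtain ⟨k, θ, hθ, hfθ⟩ := hf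
  simp only [hfθ, TypeSpace.restrict_commonExtension]
  exact integrable_finsetSum _ fun j _ => Integrable.fintype_prod_dep fun i =>
    (μ i).integrable (hθ j i).continuous

/-- The product functional on sums of products. -/
def productFunctional [NeZero n] : sumOfProducts L M X →ₗ[ℝ] ℝ where
  toFun f := ∫ q, f.1 (TypeSpace.commonExtension q) ∂Measure.pi fun i => (μ i).1
  map_add' f g := integral_add (IsSumOfProducts.integrable_commonExtension μ f.2)
    (IsSumOfProducts.integrable_commonExtension μ g.2)
  map_smul' c _ := integral_const_mul c _

theorem productFunctional_nonneg [NeZero n] (f : sumOfProducts L M X)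
    (hf : 0 ≤ (f : C(TypeSpace L M (Σ i, X i), ℝ))) : 0 ≤ productFunctional μ f :=
  integral_nonneg fun _ => hf _

theorem productFunctional_one [NeZero n] :
    productFunctional μ ⟨1, one_mem_sumOfProducts⟩ = 1 := by
  simp [productFunctional]

variable {μ}

theorem integral_prod_commonExtension (θ : ∀ i, TypeSpace L M (X i) → ℝ) :
    ∫ q, ∏ i, θ i ((TypeSpace.commonExtension q).restrict i) ∂(Measure.pi fun i => (μ i).1) =
      ∏ i, ∫ q, θ i q ∂(μ i).1 := by
  simp only [TypeSpace.restrict_commonExtension]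
  exact integral_fintype_prod_eq_prod θ

/-- Product measures are the extensions of the product functional. -/
theorem isProductMeasure_iff [NeZero n] {ω : KeislerMeasure L M (Σ i, X i)} :
    IsProductMeasure μ ω ↔
      ∀ f : sumOfProducts L M X, ∫ p, f.1 p ∂ω.1 = productFunctional μ f := by
  constructor
  · rintro h ⟨f, k, θ, hθ, hfθ⟩
    simp only [productFunctional, LinearMap.coe_mk, AddHom.coe_mk, hfθ]
    rw [integral_finsetSum, integral_finsetSum]
    · exact Finset.sum_congr rfl fun j _ =>
        (h (θ j) (hθ j)).trans (integral_prod_commonExtension (θ j)).symm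
    · exact fun j _ => (isSumOfProducts_prod (hθ j)).integrable_commonExtension μ
    · exact fun j _ => ω.integrable (isSumOfProducts_prod (hθ j)).continuous
  · intro h θ hθ
    have hs := isSumOfProducts_prod hθ
    exact (h ⟨⟨_, hs.continuous⟩, hs⟩).trans (integral_prod_commonExtension θ)

variable (μ) in
/-- Some product measure attains the upper envelope of the product functional at `φ`. -/
theorem exists_isProductMeasure [NeZero n] (φ : C(TypeSpace L M (Σ i, X i), ℝ)) :
    ∃ ω : KeislerMeasure L M (Σ i, X i), IsProductMeasure μ ω ∧
      ∫ p, φ p ∂ω.1 = upperEnvelope (productFunctional μ) φ := by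
  obtain ⟨ω, h1, h2, h3, h4⟩ := exists_regular_probability_extension one_mem_sumOfProducts
    (productFunctional_nonneg μ) (productFunctional_one μ) φ
  exact ⟨⟨ω, h1, h2⟩, isProductMeasure_iff.2 h3, h4⟩

/-- Two Keisler measures that agree on continuous functions are equal. -/
theorem KeislerMeasure.ext_of_integral {X : Type x} {ω ω' : KeislerMeasure L M X}
    (h : ∀ φ : C(TypeSpace L M X, ℝ), ∫ p, φ p ∂ω.1 = ∫ p, φ p ∂ω'.1) : ω = ω' :=
  Subtype.ext (regular_measure_ext h)

/-- The measures attaining the envelope at φ and at -φ coincide by uniqueness. -/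
theorem WeaklyOrthogonal.upperEnvelope_neg [NeZero n] (h : WeaklyOrthogonal μ)
    (φ : C(TypeSpace L M (Σ i, X i), ℝ)) :
    upperEnvelope (productFunctional μ) (-φ) = -upperEnvelope (productFunctional μ) φ := by
  obtain ⟨ω, hω, hφ⟩ := exists_isProductMeasure μ φ
  obtain ⟨ω', hω', hφ'⟩ := exists_isProductMeasure μ (-φ)
  rw [← hφ, ← hφ', h.unique hω' hω, ← integral_neg]
  rfl

theorem WeaklyOrthogonal.exists_between [NeZero n] (h : WeaklyOrthogonal μ)
    (φ : C(TypeSpace L M (Σ i, X i), ℝ)) {ε : ℝ} (hε : 0 < ε) :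
    ∃ f g : sumOfProducts L M X, (f : C(TypeSpace L M (Σ i, X i), ℝ)) ≤ φ ∧
      φ ≤ (g : C(TypeSpace L M (Σ i, X i), ℝ)) ∧ productFunctional μ (g - f) ≤ ε := by
  obtain ⟨g, hg, hg'⟩ := exists_lt_upperEnvelope_add (Λ := productFunctional μ)
    one_mem_sumOfProducts φ (half_pos hε)
  obtain ⟨f, hf, hf'⟩ := exists_lt_upperEnvelope_add (Λ := productFunctional μ)
    one_mem_sumOfProducts (-φ) (half_pos hε)
  refine ⟨-f, g, neg_le.1 hf, hg, ?_⟩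
  rw [h.upperEnvelope_neg] at hf'
  rw [map_sub, map_neg]
  linarith

end ProductMeasures
end MetricLanguage
end

/-! ### The criterion for weak orthogonality -/

theorem mainTheorem5 (L : MetricLanguage.{u, v}) (M : Type w)
    [MetricSpace M] [CompleteSpace M] [Nonempty M] [L.Interpretation M]
    (n : ℕ) (hn : 1 ≤ n) (X : Fin n → Type x) (μ : ∀ i, L.KeislerMeasure M (X i)) :
    MetricLanguage.WeaklyOrthogonal μ ↔
      ∀ φ : L.TypeSpace M (Σ i, X i) → ℝ, MetricLanguage.IsDefinablePredicate φ →
        ∀ ε : ℝ, 0 < ε →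
          ∃ ψm ψp : L.TypeSpace M (Σ i, X i) → ℝ,
            MetricLanguage.IsDefinablePredicate ψm ∧ MetricLanguage.IsDefinablePredicate ψp ∧
            MetricLanguage.IsSumOfProducts ψm ∧ MetricLanguage.IsSumOfProducts ψp ∧
            (∀ p, ψm p ≤ φ p ∧ φ p ≤ ψp p) ∧
            ∀ ω : L.KeislerMeasure M (Σ i, X i), MetricLanguage.IsProductMeasure μ ω →
              ∫ p, (ψp p - ψm p) ∂ω.1 ≤ ε := by
  open MetricLanguage in
  have : NeZero n := ⟨by omega⟩
  constructor
  · intro h φ hφ ε hε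
    obtain ⟨f, g, hf, hg, hfg⟩ := h.exists_between ⟨φ, hφ.continuous⟩ hε
    refine ⟨f, g, isDefinablePredicate_iff_continuous.2 f.1.continuous,
      isDefinablePredicate_iff_continuous.2 g.1.continuous, f.2, g.2,
      fun p => ⟨hf p, hg p⟩, fun ω hω => ?_⟩
    exact (isProductMeasure_iff.1 hω (g - f)).trans_le hfg
  · intro h
    -- Only existence matters here; the function 0 is arbitrary.
    obtain ⟨ω₀, hω₀, -⟩ := exists_isProductMeasure μ 0
    have key : ∀ ω ω' : L.KeislerMeasure M (Σ i, X i), IsProductMeasure μ ω →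
        IsProductMeasure μ ω' → ∀ φ : C(L.TypeSpace M (Σ i, X i), ℝ),
        ∫ p, φ p ∂ω.1 ≤ ∫ p, φ p ∂ω'.1 := by
      intro ω ω' hω hω' φ
      refine le_of_forall_pos_le_add fun ε hε => ?_
      obtain ⟨f, g, -, -, hf, hg, hfg, hle⟩ :=
        h φ (isDefinablePredicate_iff_continuous.2 φ.continuous) ε hε
      -- The chain is ∫φ dω ≤ ∫g dω = ∫g dω' ≤ ∫f dω' + ε ≤ ∫φ dω' + ε; the equality holds because g
      -- lies in W.
      have hgω := (isProductMeasure_iff.1 hω ⟨⟨g, hg.continuous⟩, hg⟩).trans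
        (isProductMeasure_iff.1 hω' ⟨⟨g, hg.continuous⟩, hg⟩).symm
      simp only [ContinuousMap.coe_mk] at hgω
      have h1 := hle ω' hω'
      rw [integral_sub (ω'.integrable hg.continuous) (ω'.integrable hf.continuous)] at h1
      have h2 := integral_mono (ω.integrable φ.continuous) (ω.integrable hg.continuous)
        fun p => (hfg p).2
      have h3 := integral_mono (ω'.integrable hf.continuous) (ω'.integrable φ.continuous)
        fun p => (hfg p).1
      linarith
    exact ⟨ω₀, hω₀, fun ω hω => KeislerMeasure.ext_of_integral fun φ =>
      le_antisymm (key _ _ hω hω₀ φ) (key _ _ hω₀ hω φ)⟩
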